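/- Let $\kappa$ be an infinite regular cardinal. Call a map $p\colon E\to B$ of simplicial sets \emph{$\kappa$-small} if for every $n\ge 0$ and every $n$-simplex $b\in B_n$ the fiber $\{e\in E_n : p(e)=b\}$ has cardinality less than $\kappa$. A \emph{Kan fibration} is a map with the right lifting property against all horn inclusions $\Lambda^n_k\to\Delta^n$ ($n\ge 1$, $0\le k\le n$), and a \emph{trivial cofibration} is a monomorphism that is a weak homotopy equivalence. Here a map $f\colon X\to Y$ is a \emph{weak homotopy equivalence} if for every Kan complex $K$ precomposition with $f$ induces a bijection $[Y,K]\to[X,K]$ on simplicial homotopy classes of maps (equivalently, if its geometric realization is a weak homotopy equivalence of topological spaces). Theorem. The category of simplicial sets satisfies the fibration extension property: for every $\kappa$-small Kan fibration $q\colon D\to A$ and every trivial cofibration $j\colon A\to B$ of simplicial sets, there exist a $\kappa$-small Kan fibration $p\colon E\to B$ and a map $k\colon D\to E$ such that the square $$\begin{array}{ccc} D & \xrightarrow{\;k\;} & E\\ {\scriptstyle q}\downarrow & & \downarrow{\scriptstyle p}\\ A & \xrightarrow{\;j\;} & B\end{array}$$ is a pullback. -/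

import Mathlib

open CategoryTheory HomotopicalAlgebra SSet.modelCategoryQuillen

universe u

namespace SSet

/-- The set `[X, K]` of homotopy classes of maps `X ⟶ K`: the quotient of the set of maps by the
equivalence relation generated by simplicial homotopy `X ⊗ Δ[1] ⟶ K`, i.e. the set of connected
components of the simplicial mapping space. -/
def MapClass (X K : SSet.{u}) : Type u :=
  Quot fun f g : X ⟶ K ↦ Nonempty (Homotopy f g)

/-- The class of a map. -/
def MapClass.mk {X K : SSet.{u}} (f : X ⟶ K) : MapClass X K :=
  Quot.mk _ f

/-- Precomposition with `f : X ⟶ Y`, as a map `[Y, K] → [X, K]`. -/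
def MapClass.precomp {X Y : SSet.{u}} (f : X ⟶ Y) (K : SSet.{u}) :
    MapClass Y K → MapClass X K :=
  Quot.map (fun h ↦ f ≫ h) fun _ _ ⟨H⟩ ↦
    ⟨RelativeMorphism.Homotopy.precomp H (RelativeMorphism.botEquiv.symm f)
      (φψ := Subcomplex.isInitialBot.to _) (Subcomplex.isInitialBot.hom_ext _ _)⟩

/-- A map `f : X ⟶ Y` of simplicial sets is a weak homotopy equivalence if for every Kan complex
`K` the map `[Y, K] → [X, K]` given by precomposition with `f` is bijective. -/
def IsWeakHomotopyEquivalence {X Y : SSet.{u}} (f : X ⟶ Y) : Prop :=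
  ∀ K : SSet.{u}, KanComplex K → Function.Bijective (MapClass.precomp f K)

/-- A trivial cofibration of simplicial sets: a monomorphism which is a weak homotopy
equivalence. -/
def IsTrivialCofibration {X Y : SSet.{u}} (j : X ⟶ Y) : Prop :=
  Cofibration j ∧ IsWeakHomotopyEquivalence j

/-- A map `p : E ⟶ B` of simplicial sets is `κ`-small if the fiber of `p` over each simplex of `B`
has cardinality `< κ`. -/
def IsSmallMap (κ : Cardinal.{u}) {E B : SSet.{u}} (p : E ⟶ B) : Prop :=
  ∀ (n : SimplexCategoryᵒᵖ) (b : B.obj n), Cardinal.mk {e : E.obj n // p.app n e = b} < κ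

/-- A small Kan fibration: a `κ`-small map with the right lifting property against the horn
inclusions. -/
def IsSmallKanFibration (κ : Cardinal.{u}) {E B : SSet.{u}} (p : E ⟶ B) : Prop :=
  Fibration p ∧ IsSmallMap κ p

end SSet

namespace SSet

open MonoidalCategory Simplicial Opposite

/-! The `κ`-small Kan fibrations are classified, strictly, by a simplicial set `Family.classifier
κ`. Its simplices are the families over standard simplices, with members in a fixed set of
cardinality `κ`, whose total space is a fibration. Fixing the labels makes pullback functorial on
the nose, and maps `X ⟶ classifier κ` then amount to families over `X` with fibrant projection
(`ofMap_injective`, `ofMap_classify`, `fibration_proj_ofMap`). If the classifier is a Kan complex,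
then the classifying map of `q` extends along `j` (`IsTrivialCofibration.exists_extension`), and the
family classified by the extension is the required fibration.

That the classifier is Kan is the theorem for horn inclusions (`exists_extension_horn`), combined
with `Family.exists_realignment`, which turns an extension up to isomorphism into a strict one.

For a horn `A` in a simplex `B` there are a map `g : B ⟶ A` and a homotopy on `A` between the
identity and the restriction of `g`. Lifting it to `D` gives a transport map from `D` to the
pullback of `D` along the restriction of `g`. The pullback of `D` along `g` lives over all of `B`,
but over `A` it is only homotopy equivalent to `D`. So a simplex of the extension over `b` is a
simplex `x` of `D` over `g b`, together with a section `y` of `D` over the part of `b` in `A` whose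
transport is `x`. Over `A` the datum `y` determines `x`, which gives back `D`. The projection is a
fibration because transport is invertible up to relative homotopy (`exists_section_and_homotopy`).
-/

lemma app_congr {X Y : SSet.{u}} {f g : X ⟶ Y} (h : f = g) {n : SimplexCategoryᵒᵖ}
    (x : X.obj n) : f.app n x = g.app n x := by rw [h]

lemma app_map {X Y : SSet.{u}} (f : X ⟶ Y) {n m : SimplexCategoryᵒᵖ} (φ : n ⟶ m)
    (x : X.obj n) : f.app m (X.map φ x) = Y.map φ (f.app n x) :=
  NatTrans.naturality_apply f φ x

/-- A single-valued total relation compatible with the simplicial operators defines a map. -/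
lemma exists_hom_of_rel {X Y : SSet.{u}} (R : ∀ n, X.obj n → Y.obj n → Prop)
    (hex : ∀ n x, ∃ y, R n x y) (huniq : ∀ n x y y', R n x y → R n x y' → y = y')
    (hmap : ∀ {n m} (f : n ⟶ m) x y, R n x y → R m (X.map f x) (Y.map f y)) :
    ∃ g : X ⟶ Y, ∀ n x, R n x (g.app n x) := by
  choose F hF using hex
  refine ⟨{ app n := ↾(F n), naturality n m f := ?_ }, fun n x ↦ hF n x⟩
  ext x
  exact huniq _ _ _ _ (hF _ _) (hmap f _ _ (hF _ _))

/-! ### The interval and homotopy lifting -/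

/-- The simplicial interval. -/
def interval : SSet.{u} := Δ[1]

/-- The degenerate simplices at a vertex of the interval. -/
def interval.vertex (e : Fin 2) (n : SimplexCategoryᵒᵖ) : interval.{u}.obj n :=
  stdSimplex.const 1 e n

/-- The simplex of a product given by a pair of simplices. -/
def pair {X Y : SSet.{u}} {n : SimplexCategoryᵒᵖ} (x : X.obj n) (y : Y.obj n) :
    (X ⊗ Y).obj n := (x, y)

lemma exists_pair {X Y : SSet.{u}} {n : SimplexCategoryᵒᵖ} (z : (X ⊗ Y).obj n) :
    ∃ (x : X.obj n) (y : Y.obj n), z = pair x y := ⟨z.1, z.2, rfl⟩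

lemma map_pair {X Y : SSet.{u}} {n m : SimplexCategoryᵒᵖ} (φ : n ⟶ m) (x : X.obj n)
    (y : Y.obj n) : (X ⊗ Y).map φ (pair x y) = pair (X.map φ x) (Y.map φ y) := rfl

lemma pair_inj {X Y : SSet.{u}} {n : SimplexCategoryᵒᵖ} {x x' : X.obj n} {y y' : Y.obj n}
    (h : pair x y = pair x' y') : x = x' ∧ y = y' := Prod.mk.inj h

lemma interval.vertex_ne (n : SimplexCategoryᵒᵖ) :
    interval.vertex.{u} 0 n ≠ interval.vertex 1 n := by
  intro h
  have : (0 : Fin 2) = 1 :=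
    congrArg (fun s : (Δ[1] : SSet.{u}).obj n ↦ stdSimplex.asOrderHom s 0) h
  simp at this

/-- The inclusion of `X` in `X ⊗ interval` at a vertex of the interval. -/
def atVertex (e : Fin 2) (X : SSet.{u}) : X ⟶ X ⊗ interval where
  app n := ↾(fun x ↦ pair x (interval.vertex e n))
  naturality _ _ _ := rfl

lemma mem_horn_one_iff (e : Fin 2) {n : SimplexCategoryᵒᵖ} (s : interval.{u}.obj n) :
    s ∈ (horn.{u} 1 e).obj n ↔ s = interval.vertex e n := by
  induction n using Opposite.rec with | _ n
  induction n using SimplexCategory.rec with | _ n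
  suffices H : ∀ s : (Δ[1] : SSet.{u}) _⦋n⦌, (∃ (j : Fin 2) (_ : j ≠ e), j ∉ Set.range s) ↔
      s = stdSimplex.const 1 e (op ⦋n⦌) from
    (mem_horn_iff_notMem_range s e).trans (H s)
  intro s
  constructor
  · rintro ⟨j, hj, h⟩
    refine stdSimplex.ext _ _ fun i ↦ ?_
    have : s i ≠ j := fun h' ↦ h ⟨i, h'⟩
    change s i = e
    generalize s i = a at *
    omega
  · rintro rfl
    refine ⟨1 - e, by fin_cases e <;> simp, ?_⟩
    rintro ⟨i, hi⟩
    change e = 1 - e at hi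
    revert hi
    fin_cases e <;> simp

/-- The homotopy lifting property of fibrations, relative to a subcomplex. -/
lemma exists_homotopy_lift {E B : SSet.{u}} (p : E ⟶ B) [Fibration p] {T : SSet.{u}}
    (S : T.Subcomplex) (e : Fin 2) (f : T ⟶ E) (K : (S : SSet) ⊗ interval ⟶ E)
    (H : T ⊗ interval ⟶ B)
    (hf : ∀ n (x : T.obj n), p.app n (f.app n x) = H.app n (pair x (interval.vertex e n)))
    (hK : ∀ n (x : T.obj n) (hx : x ∈ S.obj n) (s : interval.obj n),
      p.app n (K.app n (pair ⟨x, hx⟩ s)) = H.app n (pair x s))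
    (hfK : ∀ n (x : T.obj n) (hx : x ∈ S.obj n),
      f.app n x = K.app n (pair ⟨x, hx⟩ (interval.vertex e n))) :
    ∃ L : T ⊗ interval ⟶ E, (∀ n (z : (T ⊗ interval).obj n), p.app n (L.app n z) = H.app n z) ∧
      (∀ n (x : T.obj n), L.app n (pair x (interval.vertex e n)) = f.app n x) ∧
      ∀ n (x : T.obj n) (hx : x ∈ S.obj n) (s : interval.obj n),
        L.app n (pair x s) = K.app n (pair ⟨x, hx⟩ s) := by
  -- The horn in `Δ[1]` is the vertex `e`, so `f` and `K` glue to a map on `W`, and `W` is anodyne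
  -- in the cylinder as a pushout-product with a horn inclusion.
  let W : (T ⊗ interval).Subcomplex := S.unionProd (horn.{u} 1 e)
  have hW (n) (x : T.obj n) (s : interval.obj n) :
      pair x s ∈ W.obj n ↔ s = interval.vertex e n ∨ x ∈ S.obj n :=
    (Subcomplex.mem_unionProd_iff S (horn.{u} 1 e) (x := (x, s))).trans
      (or_congr_left (mem_horn_one_iff e s))
  obtain ⟨g, hg⟩ := exists_hom_of_rel (X := (W : SSet)) (Y := E)
    (fun n x y ↦ ∃ (t : T.obj n) (s : interval.obj n), x.1 = pair t s ∧
      ((s = interval.vertex e n ∧ y = f.app n t) ∨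
      ∃ h : t ∈ S.obj n, y = K.app n (pair ⟨t, h⟩ s)))
    (by
      rintro n ⟨x, hx⟩
      obtain ⟨x, s, rfl⟩ := exists_pair x
      obtain h | h := (hW n x s).1 hx
      · exact ⟨_, x, s, rfl, Or.inl ⟨h, rfl⟩⟩
      · exact ⟨_, x, s, rfl, Or.inr ⟨h, rfl⟩⟩)
    (by
      rintro n ⟨_, hx⟩ y y' ⟨x, s, rfl, h⟩ ⟨x', s', hxs, h'⟩
      obtain ⟨rfl, rfl⟩ := pair_inj hxs
      obtain ⟨h1, rfl⟩ | ⟨h1, rfl⟩ := h <;> obtain ⟨h2, rfl⟩ | ⟨h2, rfl⟩ := h'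
      · rfl
      · subst h1; exact hfK _ _ _
      · subst h2; exact (hfK _ _ _).symm
      · rfl)
    (by
      rintro n m φ ⟨_, hx⟩ y ⟨x, s, rfl, h⟩
      refine ⟨T.map φ x, interval.map φ s, rfl, ?_⟩
      obtain ⟨rfl, rfl⟩ | ⟨h1, rfl⟩ := h
      · exact Or.inl ⟨rfl, (app_map f φ x).symm⟩
      · exact Or.inr ⟨S.map φ h1, (app_map K φ _).symm⟩)
  have sq : CommSq g W.ι p H := ⟨by
    ext n ⟨z, hx⟩
    obtain ⟨x, s, hz, h⟩ := hg n ⟨z, hx⟩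
    change p.app n (g.app n _) = H.app n z
    obtain ⟨h1, h2⟩ | ⟨h1, h2⟩ := h
    · rw [h2, hf, ← h1, ← hz]
    · rw [h2, hK, ← hz]⟩
  have : HasLiftingProperty W.ι p :=
    anodyneExtensions_unionProd_ι S _ (anodyneExtensions.horn_ι e) p
      ((HomotopicalAlgebra.fibration_iff p).1 inferInstance)
  have hl (n) (x) (hx : x ∈ W.obj n) : sq.lift.app n x = g.app n ⟨x, hx⟩ :=
    app_congr sq.fac_left (⟨x, hx⟩ : (W : SSet).obj n)
  refine ⟨sq.lift, fun n z ↦ app_congr sq.fac_right z, ?_, ?_⟩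
  · intro n x
    rw [hl _ _ ((hW _ _ _).2 (Or.inl rfl))]
    obtain ⟨x', s, hx, ⟨-, h⟩ | ⟨h1, h⟩⟩ := hg n ⟨_, (hW _ _ _).2 (Or.inl rfl)⟩
    · rw [h, ← (pair_inj hx).1]
    · obtain ⟨rfl, rfl⟩ := pair_inj hx
      rw [h, hfK]
  · intro n x hx s
    rw [hl _ _ ((hW _ _ _).2 (Or.inr hx))]
    obtain ⟨x', s', hx', ⟨h1, h⟩ | ⟨h1, h⟩⟩ := hg n ⟨_, (hW n x s).2 (Or.inr hx)⟩ <;>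
      obtain ⟨rfl, rfl⟩ := pair_inj hx'
    · subst h1
      rw [h, hfK]
    · exact h

/-! ### Extending a map along a lifted contraction -/

/-- A homotopy between the identity of a subcomplex `A ⊆ B` and the restriction of a map
`g : B ⟶ A`, together with a lift to a simplicial set `D` over `A`. -/
structure LiftedContraction {B : SSet.{u}} (A : B.Subcomplex) {D : SSet.{u}}
    (q : D ⟶ (A : SSet)) where
  /-- the extension to `B` of the end of the homotopy -/
  g : B ⟶ (A : SSet)
  /-- the end at which the homotopy is the identity -/
  e : Fin 2
  /-- the opposite end -/
  e' : Fin 2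
  /-- the homotopy -/
  h : (A : SSet) ⊗ interval ⟶ (A : SSet)
  /-- the lift of the homotopy -/
  L : D ⊗ interval ⟶ D
  h_e : ∀ n (a : (A : SSet).obj n), h.app n (pair a (interval.vertex e n)) = a
  h_e' : ∀ n (a : (A : SSet).obj n), h.app n (pair a (interval.vertex e' n)) = g.app n a.1
  q_L : ∀ n (d : D.obj n) (s : interval.obj n),
    q.app n (L.app n (pair d s)) = h.app n (pair (q.app n d) s)
  L_e : ∀ n (d : D.obj n), L.app n (pair d (interval.vertex e n)) = d

namespace LiftedContraction

variable {B : SSet.{u}} {A : B.Subcomplex} {D : SSet.{u}} {q : D ⟶ (A : SSet)}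
  (c : LiftedContraction A q)

/-- The simplices of the extension of `D` to `B`: a simplex `b` of `B`, a simplex `x` of `D` over
`c.g b` and a partial section `y` of `D` over the part of `b` in `A`, whose image at the end of the
homotopy is `x`. -/
structure Simplex (m : SimplexCategoryᵒᵖ) where
  b : B.obj m
  x : D.obj m
  y : ∀ {l : SimplexCategoryᵒᵖ} (f : m ⟶ l), B.map f b ∈ A.obj l → D.obj l
  q_x : q.app m x = c.g.app m b
  q_y : ∀ {l : SimplexCategoryᵒᵖ} (f : m ⟶ l) (h : B.map f b ∈ A.obj l),
    (q.app l (y f h)).1 = B.map f b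
  y_comp : ∀ {l l' : SimplexCategoryᵒᵖ} (f : m ⟶ l) (φ : l ⟶ l') (h : B.map f b ∈ A.obj l)
    (h' : B.map (f ≫ φ) b ∈ A.obj l'), y (f ≫ φ) h' = D.map φ (y f h)
  L_y : ∀ {l : SimplexCategoryᵒᵖ} (f : m ⟶ l) (h : B.map f b ∈ A.obj l),
    c.L.app l (pair (y f h) (interval.vertex c.e' l)) = D.map f x

variable {c}

lemma Simplex.ext' {m : SimplexCategoryᵒᵖ} {z z' : c.Simplex m} (hb : z.b = z'.b)
    (hx : z.x = z'.x) (hy : ∀ {l : SimplexCategoryᵒᵖ} (f : m ⟶ l) (h : B.map f z.b ∈ A.obj l)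
      (h' : B.map f z'.b ∈ A.obj l), z.y f h = z'.y f h') : z = z' := by
  obtain ⟨b, x, y, _, _, _, _⟩ := z
  obtain ⟨b', x', y', _, _, _, _⟩ := z'
  obtain rfl : b = b' := hb
  obtain rfl : x = x' := hx
  obtain rfl : @y = @y' := by
    funext l f h
    exact hy f h h
  rfl

lemma Simplex.y_congr {m l : SimplexCategoryᵒᵖ} (z : c.Simplex m) {f f' : m ⟶ l} (hf : f = f')
    (h : B.map f z.b ∈ A.obj l) : z.y f h = z.y f' (hf ▸ h) := by
  subst hf; rfl

lemma map_map {X : SSet.{u}} {m n l : SimplexCategoryᵒᵖ} (φ : m ⟶ n) (f : n ⟶ l) (x : X.obj m) :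
    X.map f (X.map φ x) = X.map (φ ≫ f) x := (Functor.map_comp_apply X φ f x).symm

/-- The action of a simplicial operator on `Simplex`. -/
def Simplex.map {m n : SimplexCategoryᵒᵖ} (φ : m ⟶ n) (z : c.Simplex m) : c.Simplex n where
  b := B.map φ z.b
  x := D.map φ z.x
  y f h := z.y (φ ≫ f) (by rwa [← map_map])
  q_x := by rw [app_map, app_map, z.q_x]
  q_y f h := by rw [z.q_y, map_map]
  y_comp {l l'} f ψ h h' := by
    rw [← z.y_comp (φ ≫ f) ψ (by rwa [← map_map]) (by rwa [Category.assoc, ← map_map])]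
    exact z.y_congr (Category.assoc _ _ _).symm _
  L_y f h := by rw [z.L_y, map_map]

variable (c)

/-- The extension of `D` to `B`. -/
def extension : SSet.{u} where
  obj m := c.Simplex m
  map φ := ↾(Simplex.map φ)
  map_id m := by
    ext z
    refine Simplex.ext' (Functor.map_id_apply B _ _) (Functor.map_id_apply D _ _) ?_
    intro l f h h'
    exact z.y_congr (Category.id_comp _) _
  map_comp φ ψ := by
    ext z
    refine Simplex.ext' (Functor.map_comp_apply B _ _ _) (Functor.map_comp_apply D _ _ _) ?_
    intro l f h h'
    exact z.y_congr (Category.assoc _ _ _) _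

/-- The projection of the extension. -/
def proj : c.extension ⟶ B where
  app m := ↾(fun z : c.Simplex m ↦ z.b)
  naturality _ _ _ := rfl

/-- The second component of the simplices of the extension. -/
def toD : c.extension ⟶ D where
  app m := ↾(fun z : c.Simplex m ↦ z.x)
  naturality _ _ _ := rfl

/-- The inclusion of `D` in the extension. -/
def incl : D ⟶ c.extension where
  app m := ↾(fun d : D.obj m ↦
    { b := (q.app m d).1
      x := c.L.app m (pair d (interval.vertex c.e' m))
      y f _ := D.map f d
      q_x := by rw [c.q_L, c.h_e']
      q_y f h := by rw [app_map]; rfl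
      y_comp f φ h h' := (map_map _ _ _).symm
      L_y f h := by rw [← app_map]; rfl })
  naturality m n φ := by
    ext d
    refine Simplex.ext' (by exact congrArg Subtype.val (app_map q φ d)) ?_ ?_
    · exact (app_map c.L φ (pair d (interval.vertex c.e' m)))
    · intro l f h h'
      exact map_map φ f d

end LiftedContraction

/-- Squares of simplicial sets are cartesian if they are so on simplices. -/
lemma isPullback_of_existsUnique {D A E B : SSet.{u}} {k : D ⟶ E} {q : D ⟶ A} {p : E ⟶ B}
    {j : A ⟶ B} (comm : k ≫ p = q ≫ j)
    (inj : ∀ n (d d' : D.obj n), k.app n d = k.app n d' → q.app n d = q.app n d' → d = d')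
    (surj : ∀ n (e : E.obj n) (a : A.obj n), p.app n e = j.app n a →
      ∃ d, k.app n d = e ∧ q.app n d = a) : IsPullback k q p j := by
  refine IsPullback.of_forall_isPullback_app fun n ↦ ?_
  rw [Limits.Types.isPullback_iff]
  exact ⟨congr_app comm n, fun d d' h ↦ inj n d d' h.1 h.2, fun e a h ↦ surj n e a h⟩

lemma _root_.Cardinal.mk_pi_lt_of_finite {κ : Cardinal.{u}} (hκ : Cardinal.aleph0 ≤ κ) {ι : Type}
    [Finite ι] (α : ι → Type u) (h : ∀ i, Cardinal.mk (α i) < κ) :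
    Cardinal.mk (∀ i, α i) < κ := by
  induction ι using Finite.induction_empty_option with
  | of_equiv e ih =>
    rw [← Cardinal.mk_congr (Equiv.piCongrLeft α e)]
    exact ih _ (fun i ↦ h _)
  | h_empty =>
    rw [Cardinal.mk_eq_one]
    exact Cardinal.one_lt_aleph0.trans_le hκ
  | h_option ih =>
    rw [Cardinal.mk_congr (Equiv.piOptionEquivProd), Cardinal.mk_prod, Cardinal.lift_id,
      Cardinal.lift_id]
    exact Cardinal.mul_lt_of_lt hκ (h _) (ih _ (fun i ↦ h _))

namespace LiftedContraction

variable {B : SSet.{u}} {A : B.Subcomplex} {D : SSet.{u}} {q : D ⟶ (A : SSet)}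
  (c : LiftedContraction A q)

/-- When `b` lies in `A`, the partial section is total: its value at the identity operator
determines its other values by `y_comp`, and `x` by `L_y`. -/
lemma isPullback : IsPullback c.incl q c.proj A.ι := by
  refine isPullback_of_existsUnique rfl ?_ ?_
  · intro n d d' h _
    have key (d : D.obj n) (H) : d = (c.incl.app n d : c.Simplex n).y (𝟙 n) H :=
      (Functor.map_id_apply D _ d).symm
    have hd (d : D.obj n) : B.map (𝟙 n) (c.incl.app n d : c.Simplex n).b ∈ A.obj n := by
      rw [Functor.map_id_apply]; exact (q.app n d).2
    rw [key d (hd d), key d' (hd d')]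
    congr 1
  · rintro n (z : c.Simplex n) a h
    have ha : B.map (𝟙 n) z.b ∈ A.obj n := by
      rw [Functor.map_id_apply]
      have := a.2
      rwa [show a.1 = z.b from h.symm] at this
    have hq : q.app n (z.y (𝟙 n) ha) = a := by
      refine Subtype.ext ((z.q_y _ _).trans ?_)
      rw [Functor.map_id_apply]
      exact h
    refine ⟨z.y (𝟙 n) ha, Simplex.ext' ?_ ?_ ?_, hq⟩
    · exact (congrArg Subtype.val hq).trans h.symm
    · exact (z.L_y _ _).trans (Functor.map_id_apply _ _ _)
    · intro l f h h'
      refine (z.y_comp (𝟙 n) f ha (by rwa [Category.id_comp])).symm.trans ?_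
      exact z.y_congr (Category.id_comp _) _

/-- Every operator is a degeneracy of a face, so a partial section is determined by its values on
faces. Only finitely many operators then matter for the cardinality bound. -/
lemma Simplex.y_eq_of_mono {c : LiftedContraction A q} {n : SimplexCategoryᵒᵖ}
    {z z' : c.Simplex n} (hb : z.b = z'.b)
    (hy : ∀ {l : SimplexCategoryᵒᵖ} (f : n ⟶ l) (h : B.map f z.b ∈ A.obj l)
      (h' : B.map f z'.b ∈ A.obj l), l.unop.len ≤ n.unop.len → z.y f h = z'.y f h')
    {l : SimplexCategoryᵒᵖ} (f : n ⟶ l) (h : B.map f z.b ∈ A.obj l)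
    (h' : B.map f z'.b ∈ A.obj l) : z.y f h = z'.y f h' := by
  let i := Limits.image.ι f.unop
  let r := Limits.factorThruImage f.unop
  have hf : f = i.op ≫ r.op := by
    rw [← op_comp, Limits.image.fac]; rfl
  have : IsSplitEpi r := isSplitEpi_of_epi r
  have hs : r.op ≫ (section_ r).op = 𝟙 _ := by
    rw [← op_comp, IsSplitEpi.id]; rfl
  have hi : i.op = f ≫ (section_ r).op := by
    refine Eq.trans ?_ (congrArg (· ≫ (section_ r).op) hf.symm)
    rw [Category.assoc, hs, Category.comp_id]
  -- A degeneracy has a section, so the face underlying a simplex of `A` is itself in `A`.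
  have mem : B.map i.op z.b ∈ A.obj _ := by
    rw [hi, ← map_map]
    exact A.map _ h
  have mem' : B.map i.op z'.b ∈ A.obj _ := by rwa [← hb]
  have e (z : c.Simplex n) (h : B.map f z.b ∈ A.obj l) (mem : B.map i.op z.b ∈ A.obj _) :
      z.y f h = D.map r.op (z.y i.op mem) := by
    rw [← z.y_comp i.op r.op mem (hf ▸ h)]
    exact z.y_congr hf _
  rw [e z h mem, e z' h' mem', hy i.op mem mem' (SimplexCategory.len_le_of_mono i)]

lemma isSmallMap_proj {κ : Cardinal.{u}} (hκ : κ.IsRegular) (hq : IsSmallMap κ q) :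
    IsSmallMap κ c.proj := by
  intro n b
  let ι : Type := Σ k : Fin (n.unop.len + 1), (⦋k.1⦌ ⟶ n.unop)
  -- The dependence on `h` makes this a fiber of `q` if the given simplex lies in `A`, and a
  -- singleton otherwise; a finite product of such sets stays below the infinite cardinal `κ`.
  let F (i : ι) : Type u := ∀ h : B.map i.2.op b ∈ A.obj _,
    {d : D.obj _ // q.app _ d = ⟨B.map i.2.op b, h⟩}
  have hF (i : ι) : Cardinal.mk (F i) < κ := by
    by_cases h : B.map i.2.op b ∈ A.obj _
    · let e : F i ≃ {d : D.obj _ // q.app _ d = ⟨B.map i.2.op b, h⟩} :=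
        { toFun f := f h, invFun d _ := d, left_inv _ := rfl, right_inv _ := rfl }
      rw [Cardinal.mk_congr e]
      exact hq _ _
    · have : Unique (F i) := ⟨⟨fun h' ↦ (h h').elim⟩, fun _ ↦ funext fun h' ↦ (h h').elim⟩
      rw [Cardinal.mk_eq_one]
      exact Cardinal.one_lt_aleph0.trans_le hκ.aleph0_le
  let Φ : {e : c.extension.obj n // c.proj.app n e = b} →
      {d : D.obj n // q.app n d = c.g.app n b} × (∀ i, F i) := fun z ↦
    (⟨(z.1 : c.Simplex n).x, (z.1 : c.Simplex n).q_x.trans (congrArg _ z.2)⟩,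
      fun i h ↦ ⟨(z.1 : c.Simplex n).y i.2.op (by
        have := z.2; rwa [show (z.1 : c.Simplex n).b = b from z.2]), by
        refine Subtype.ext (((z.1 : c.Simplex n).q_y _ _).trans ?_)
        exact congrArg _ z.2⟩)
  have hΦ : Function.Injective Φ := by
    rintro ⟨z, hz⟩ ⟨z', hz'⟩ h
    have hb : (z : c.Simplex n).b = (z' : c.Simplex n).b := hz.trans hz'.symm
    have h1 := (Prod.mk.inj h).1
    have h2 := (Prod.mk.inj h).2
    refine Subtype.ext (Simplex.ext' hb (congrArg Subtype.val h1) ?_)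
    refine Simplex.y_eq_of_mono hb ?_
    intro l f hm hm' hl
    induction l using Opposite.rec with | _ l
    induction l using SimplexCategory.rec with | _ l
    have h3 := congr_fun h2 ⟨⟨l, Nat.lt_succ_of_le hl⟩, f.unop⟩
    have h4 := congr_fun h3 (by
      have h5 := hm; rwa [show (z : c.Simplex n).b = b from hz] at h5)
    exact congrArg Subtype.val h4
  have : Finite ι := inferInstance
  refine (Cardinal.mk_le_of_injective hΦ).trans_lt ?_
  rw [Cardinal.mk_prod, Cardinal.lift_id, Cardinal.lift_id]
  exact Cardinal.mul_lt_of_lt hκ.aleph0_le (hq _ _)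
    (Cardinal.mk_pi_lt_of_finite hκ.aleph0_le _ hF)

end LiftedContraction

/-! ### The extension is a Kan fibration -/

lemma Subcomplex.eq_of_mk_eq {X : SSet.{u}} {A : X.Subcomplex} {n : SimplexCategoryᵒᵖ}
    {x x' : X.obj n} {h : x ∈ A.obj n} {h' : x' ∈ A.obj n}
    (e : (⟨x, h⟩ : (A : SSet).obj n) = ⟨x', h'⟩) : x = x' := Subtype.mk.inj e

namespace LiftedContraction

variable {B : SSet.{u}} {A : B.Subcomplex} {D : SSet.{u}} {q : D ⟶ (A : SSet)}
  (c : LiftedContraction A q)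

/-- Given a simplicial set `X` over `B`, partial sections of `D` over the part of `X` over `A` can
be extended from a subcomplex `S`, with prescribed transport along the homotopy, up to a homotopy
relative to `S`. -/
lemma exists_section_and_homotopy [Fibration q] {T : SSet.{u}} (v : T ⟶ (A : SSet))
    (S : T.Subcomplex) (x : T ⟶ D) (y₀ : (S : SSet) ⟶ D)
    (hx : ∀ n (t : T.obj n), q.app n (x.app n t) = c.g.app n (v.app n t).1)
    (hy₀ : ∀ n (t : T.obj n) (ht : t ∈ S.obj n), q.app n (y₀.app n ⟨t, ht⟩) = v.app n t)
    (hxy : ∀ n (t : T.obj n) (ht : t ∈ S.obj n),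
      c.L.app n (pair (y₀.app n ⟨t, ht⟩) (interval.vertex c.e' n)) = x.app n t) :
    ∃ (y : T ⟶ D) (K : T ⊗ interval ⟶ D),
      (∀ n (t : T.obj n), q.app n (y.app n t) = v.app n t) ∧
      (∀ n (t : T.obj n) (ht : t ∈ S.obj n), y.app n t = y₀.app n ⟨t, ht⟩) ∧
      (∀ n (t : T.obj n) (s : interval.obj n),
        q.app n (K.app n (pair t s)) = c.g.app n (v.app n t).1) ∧
      (∀ n (t : T.obj n), K.app n (pair t (interval.vertex 0 n)) =
        c.L.app n (pair (y.app n t) (interval.vertex c.e' n))) ∧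
      (∀ n (t : T.obj n), K.app n (pair t (interval.vertex 1 n)) = x.app n t) ∧
      (∀ n (t : T.obj n) (s : interval.obj n), t ∈ S.obj n →
        K.app n (pair t s) = x.app n t) := by
  obtain ⟨G, hG, hG', hGS⟩ := exists_homotopy_lift q S c.e' x (y₀ ▷ interval ≫ c.L)
    (v ▷ interval ≫ c.h)
    (fun n t ↦ (hx n t).trans (c.h_e' n (v.app n t)).symm)
    (fun n t ht s ↦ (c.q_L n _ s).trans
      (congrArg (fun a ↦ c.h.app n (pair a s)) (hy₀ n t ht)))
    (fun n t ht ↦ (hxy n t ht).symm)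
  -- `G` lifts the homotopy starting from `x` at the end `c.e'`; its other end is a candidate
  -- preimage of `x` under transport.
  let y : T ⟶ D := atVertex c.e T ≫ G
  have hyG (n) (t : T.obj n) : y.app n t = G.app n (pair t (interval.vertex c.e n)) := rfl
  have hqy (n) (t : T.obj n) : q.app n (y.app n t) = v.app n t := by
    rw [hyG, hG]
    exact c.h_e n (v.app n t)
  have hyS (n) (t : T.obj n) (ht : t ∈ S.obj n) : y.app n t = y₀.app n ⟨t, ht⟩ := by
    rw [hyG, hGS _ _ ht]
    exact c.L_e n _
  -- Both `G` and the transport path of `y` lift the same homotopy and agree with `y` at `c.e`. A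
  -- second lifting on `T ⊗ interval`, relative to `S` and to both ends of the new interval,
  -- compares them.
  let S' : (T ⊗ interval).Subcomplex := S.unionProd
    { obj n := {s | s = interval.vertex 0 n ∨ s = interval.vertex 1 n}
      map φ := by
        rintro s (rfl | rfl)
        · exact Or.inl rfl
        · exact Or.inr rfl }
  have hS' (n) (t : T.obj n) (a : interval.obj n) : pair t a ∈ S'.obj n ↔
      (a = interval.vertex 0 n ∨ a = interval.vertex 1 n) ∨ t ∈ S.obj n :=
    Subcomplex.mem_unionProd_iff _ _ (x := (t, a))
  obtain ⟨K', hK'⟩ := exists_hom_of_rel (X := (S' : SSet) ⊗ interval) (Y := D)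
    (fun n z d ↦ ∃ (t : T.obj n) (a : interval.obj n) (h : pair t a ∈ S'.obj n)
      (s : interval.obj n), z = pair (⟨pair t a, h⟩ : (S' : SSet).obj n) s ∧
      ((a = interval.vertex 0 n ∧ d = c.L.app n (pair (y.app n t) s)) ∨
        (a = interval.vertex 1 n ∧ d = G.app n (pair t s)) ∨
        (∃ ht : t ∈ S.obj n, d = c.L.app n (pair (y₀.app n ⟨t, ht⟩) s))))
    (by
      intro n z
      obtain ⟨⟨z, h⟩, s, rfl⟩ := exists_pair z
      obtain ⟨t, a, rfl⟩ := exists_pair z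
      obtain (ha | ha) | ht := (hS' n t a).1 h
      · exact ⟨_, t, a, h, s, rfl, Or.inl ⟨ha, rfl⟩⟩
      · exact ⟨_, t, a, h, s, rfl, Or.inr (Or.inl ⟨ha, rfl⟩)⟩
      · exact ⟨_, t, a, h, s, rfl, Or.inr (Or.inr ⟨ht, rfl⟩)⟩)
    (by
      rintro n _ d d' ⟨t, a, h, s, rfl, hd⟩ ⟨t', a', h', s', hz, hd'⟩
      obtain ⟨hz₂, rfl⟩ := pair_inj hz
      obtain ⟨rfl, rfl⟩ := pair_inj (Subcomplex.eq_of_mk_eq hz₂)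
      have h3 (ht : t ∈ S.obj n) : G.app n (pair t s) =
          c.L.app n (pair (y₀.app n ⟨t, ht⟩) s) := hGS n t ht s
      obtain ⟨ha, rfl⟩ | ⟨ha, rfl⟩ | ⟨ht, rfl⟩ := hd <;>
        obtain ⟨ha', rfl⟩ | ⟨ha', rfl⟩ | ⟨ht', rfl⟩ := hd'
      · rfl
      · exact (interval.vertex_ne n (ha.symm.trans ha')).elim
      · rw [hyS _ _ ht']
      · exact (interval.vertex_ne n (ha'.symm.trans ha)).elim
      · rfl
      · exact h3 _
      · rw [hyS _ _ ht]
      · exact (h3 _).symm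
      · rfl)
    (by
      rintro n m φ _ d ⟨t, a, h, s, rfl, hd⟩
      refine ⟨T.map φ t, interval.map φ a, S'.map φ h, interval.map φ s, rfl, ?_⟩
      obtain ⟨rfl, rfl⟩ | ⟨rfl, rfl⟩ | ⟨ht, rfl⟩ := hd
      · refine Or.inl ⟨rfl, ?_⟩
        rw [← app_map, map_pair, app_map y]
      · refine Or.inr (Or.inl ⟨rfl, ?_⟩)
        rw [← app_map, map_pair]
      · refine Or.inr (Or.inr ⟨S.map φ ht, ?_⟩)
        rw [← app_map, map_pair]
        exact congrArg (fun d ↦ c.L.app m (pair d (interval.map φ s)))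
          (app_map y₀ φ (⟨t, ht⟩ : (S : SSet).obj n)).symm)
  replace hK' (n) (t : T.obj n) (a : interval.obj n) (h : pair t a ∈ S'.obj n)
      (s : interval.obj n) : let d := K'.app n (pair (⟨pair t a, h⟩ : (S' : SSet).obj n) s)
        (a = interval.vertex 0 n ∧ d = c.L.app n (pair (y.app n t) s)) ∨
        (a = interval.vertex 1 n ∧ d = G.app n (pair t s)) ∨
        (∃ ht : t ∈ S.obj n, d = c.L.app n (pair (y₀.app n ⟨t, ht⟩) s)) := by
    obtain ⟨t', a', h', s', hz, hd⟩ := hK' n (pair (⟨pair t a, h⟩ : (S' : SSet).obj n) s)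
    obtain ⟨hz₂, rfl⟩ := pair_inj hz
    obtain ⟨rfl, rfl⟩ := pair_inj (Subcomplex.eq_of_mk_eq hz₂)
    exact hd
  obtain ⟨M, hM, hMe, hMS⟩ := exists_homotopy_lift q S' c.e
    (CartesianMonoidalCategory.fst T interval ≫ y) K'
    ((CartesianMonoidalCategory.fst T interval ≫ v) ▷ interval ≫ c.h)
    (by
      intro n z
      obtain ⟨t, a, rfl⟩ := exists_pair z
      exact (hqy n t).trans (c.h_e n (v.app n t)).symm)
    (by
      intro n z hz s
      obtain ⟨t, a, rfl⟩ := exists_pair z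
      change _ = c.h.app n (pair (v.app n t) s)
      obtain ⟨-, h⟩ | ⟨-, h⟩ | ⟨ht, h⟩ := hK' n t a hz s
      · rw [h, c.q_L, hqy]
      · rw [h, hG]; rfl
      · rw [h, c.q_L, hy₀])
    (by
      intro n z hz
      obtain ⟨t, a, rfl⟩ := exists_pair z
      change y.app n t = _
      obtain ⟨-, h⟩ | ⟨-, h⟩ | ⟨ht, h⟩ := hK' n t a hz (interval.vertex c.e n)
      · rw [h, c.L_e]
      · rw [h, hyG]
      · rw [h, c.L_e, hyS])
  -- At `c.e'` the comparison runs from the transport of `y` to `x`.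
  let K : T ⊗ interval ⟶ D := atVertex c.e' _ ≫ M
  have hK (n) (t : T.obj n) (s) : K.app n (pair t s) =
    M.app n (pair (pair t s) (interval.vertex c.e' n)) := rfl
  have h0 (n) (t : T.obj n) : pair t (interval.vertex 0 n) ∈ S'.obj n :=
    (hS' _ _ _).2 (Or.inl (Or.inl rfl))
  have h1 (n) (t : T.obj n) : pair t (interval.vertex 1 n) ∈ S'.obj n :=
    (hS' _ _ _).2 (Or.inl (Or.inr rfl))
  have hGx (n) (t : T.obj n) : G.app n (pair t (interval.vertex c.e' n)) = x.app n t := hG' n t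
  refine ⟨y, K, hqy, hyS, ?_, ?_, ?_, ?_⟩
  · intro n t s
    rw [hK, hM]
    exact c.h_e' n (v.app n t)
  · intro n t
    rw [hK, hMS _ _ (h0 n t)]
    obtain ⟨-, h⟩ | ⟨h', -⟩ | ⟨ht, h⟩ := hK' n t _ (h0 n t) (interval.vertex c.e' n)
    · exact h
    · exact (interval.vertex_ne n h').elim
    · rw [h, hyS _ _ ht]
  · intro n t
    rw [hK, hMS _ _ (h1 n t)]
    obtain ⟨h', -⟩ | ⟨-, h⟩ | ⟨ht, h⟩ := hK' n t _ (h1 n t) (interval.vertex c.e' n)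
    · exact (interval.vertex_ne n h'.symm).elim
    · rw [h, hGx]
    · rw [h, hxy]
  · intro n t s ht
    rw [hK, hMS _ _ ((hS' _ _ _).2 (Or.inr ht))]
    obtain ⟨-, h⟩ | ⟨-, h⟩ | ⟨_, h⟩ := hK' n t s ((hS' _ _ _).2 (Or.inr ht))
      (interval.vertex c.e' n)
    · rw [h, hyS _ _ ht, hxy]
    · rw [h, hGx]
    · rw [h, hxy]

/-- The component `x` lifts because `q` has the lifting property, and `y` extends from the part of
`H` over `A` by `exists_section_and_homotopy`. The transport of `y` is then only homotopic to `x`,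
so `x` is deformed, relative to `H` and over `B`, until they agree. -/
lemma hasLiftingProperty_proj [Fibration q] {X : SSet.{u}} (H : X.Subcomplex)
    [HasLiftingProperty H.ι q] : HasLiftingProperty H.ι c.proj where
  sq_hasLift {u v} sq := by
    have huv (n) (σ : X.obj n) (hσ : σ ∈ H.obj n) :
        (u.app n ⟨σ, hσ⟩ : c.Simplex n).b = v.app n σ :=
      app_congr sq.w (⟨σ, hσ⟩ : (H : SSet).obj n)
    let T : X.Subcomplex := A.preimage v
    let vT : (T : SSet) ⟶ (A : SSet) := A.fromPreimage v
    let S : (T : SSet.{u}).Subcomplex := H.preimage T.ι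
    have memA (n) (σ : X.obj n) (hσ : σ ∈ H.obj n) (ht : σ ∈ T.obj n) :
        B.map (𝟙 n) (u.app n ⟨σ, hσ⟩ : c.Simplex n).b ∈ A.obj n := by
      rw [Functor.map_id_apply, huv]
      exact ht
    let y₀ : (S : SSet) ⟶ D :=
      { app n := ↾(fun t ↦ (u.app n ⟨t.1.1, t.2⟩ : c.Simplex n).y (𝟙 n)
          (memA n t.1.1 t.2 t.1.2))
        naturality n m φ := by
          ext ⟨⟨σ, ht⟩, hσ⟩
          let z : c.Simplex n := u.app n ⟨σ, hσ⟩
          have hu : (u.app m ⟨X.map φ σ, H.map φ hσ⟩ : c.Simplex m) = z.map φ :=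
            app_map u φ ⟨σ, hσ⟩
          have h1 : B.map (𝟙 m) (z.map φ).b ∈ A.obj m := by
            rw [← hu]; exact memA m _ (H.map φ hσ) (T.map φ ht)
          have h2 : B.map φ z.b ∈ A.obj m := by
            rw [Functor.map_id_apply] at h1; exact h1
          have h3 : (u.app m ⟨X.map φ σ, H.map φ hσ⟩ : c.Simplex m).y (𝟙 m)
              (memA m _ (H.map φ hσ) (T.map φ ht)) = (z.map φ).y (𝟙 m) h1 := by
            congr 1
          refine h3.trans ?_
          refine Eq.trans ?_ (z.y_comp (𝟙 n) φ (memA n σ hσ ht) (by rwa [Category.id_comp]))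
          exact z.y_congr (by rw [Category.comp_id, Category.id_comp]) _ }
    -- A first choice of the component `x`, not yet compatible with any partial section outside `H`.
    have sqx : CommSq (u ≫ c.toD) H.ι q (v ≫ c.g) := ⟨by
      ext n ⟨σ, hσ⟩
      exact (u.app n ⟨σ, hσ⟩ : c.Simplex n).q_x.trans (congrArg _ (huv n σ hσ))⟩
    let x : X ⟶ D := sqx.lift
    have hqx (n) (σ : X.obj n) : q.app n (x.app n σ) = c.g.app n (v.app n σ) :=
      app_congr sqx.fac_right σ
    have hxH (n) (σ : X.obj n) (hσ : σ ∈ H.obj n) :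
        x.app n σ = (u.app n ⟨σ, hσ⟩ : c.Simplex n).x :=
      app_congr sqx.fac_left (⟨σ, hσ⟩ : (H : SSet).obj n)
    obtain ⟨y, K, hqy, hyS, hqK, hK0, hK1, hKS⟩ :=
      c.exists_section_and_homotopy vT S (T.ι ≫ x) y₀ (fun n t ↦ hqx n t.1)
        (fun n t ht ↦ Subtype.ext
          (((u.app n ⟨t.1, ht⟩ : c.Simplex n).q_y _ _).trans
            ((Functor.map_id_apply B n _).trans (huv n t.1 ht))))
        (fun n t ht ↦
          ((u.app n ⟨t.1, ht⟩ : c.Simplex n).L_y _ _).trans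
            ((Functor.map_id_apply D n _).trans (hxH n t.1 ht).symm))
    -- The homotopy `K` on `T` and the constant homotopy on `H` glue, since `K` is constant on the
    -- intersection.
    let R : X.Subcomplex := T ⊔ H
    obtain ⟨K', hK'⟩ := exists_hom_of_rel (X := (R : SSet) ⊗ interval) (Y := D)
      (fun n z d ↦ ∃ (σ : X.obj n) (h : σ ∈ R.obj n) (s : interval.obj n),
        z = pair (⟨σ, h⟩ : (R : SSet).obj n) s ∧
        ((∃ ht : σ ∈ T.obj n, d = K.app n (pair (⟨σ, ht⟩ : (T : SSet).obj n) s)) ∨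
          (σ ∈ H.obj n ∧ d = x.app n σ)))
      (by
        intro n z
        obtain ⟨⟨σ, h⟩, s, rfl⟩ := exists_pair z
        obtain ht | hσ := h
        · exact ⟨_, σ, Or.inl ht, s, rfl, Or.inl ⟨ht, rfl⟩⟩
        · exact ⟨_, σ, Or.inr hσ, s, rfl, Or.inr ⟨hσ, rfl⟩⟩)
      (by
        rintro n _ d d' ⟨σ, h, s, rfl, hd⟩ ⟨σ', h', s', hz, hd'⟩
        obtain ⟨hz₂, rfl⟩ := pair_inj hz
        obtain rfl := Subcomplex.eq_of_mk_eq hz₂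
        obtain ⟨ht, rfl⟩ | ⟨hσ, rfl⟩ := hd <;> obtain ⟨ht', rfl⟩ | ⟨hσ', rfl⟩ := hd'
        · rfl
        · exact hKS n ⟨_, ht⟩ s hσ'
        · exact (hKS n ⟨_, ht'⟩ s hσ).symm
        · rfl)
      (by
        rintro n m φ _ d ⟨σ, h, s, rfl, hd⟩
        refine ⟨X.map φ σ, R.map φ h, interval.map φ s, rfl, ?_⟩
        obtain ⟨ht, rfl⟩ | ⟨hσ, rfl⟩ := hd
        · refine Or.inl ⟨T.map φ ht, ?_⟩
          exact (app_map K φ _).symm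
        · refine Or.inr ⟨H.map φ hσ, ?_⟩
          rw [← app_map])
    replace hK' (n) (σ : X.obj n) (h : σ ∈ R.obj n) (s : interval.obj n) :
        (∃ ht : σ ∈ T.obj n, K'.app n (pair ⟨σ, h⟩ s) =
          K.app n (pair (⟨σ, ht⟩ : (T : SSet).obj n) s)) ∨
          (σ ∈ H.obj n ∧ K'.app n (pair ⟨σ, h⟩ s) = x.app n σ) := by
      obtain ⟨σ', h', s', hz, hd⟩ := hK' n (pair ⟨σ, h⟩ s)
      obtain ⟨hz₂, rfl⟩ := pair_inj hz
      obtain rfl := Subcomplex.eq_of_mk_eq hz₂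
      exact hd
    obtain ⟨N, hN, -, hNR⟩ := exists_homotopy_lift q R 1 x K'
      (CartesianMonoidalCategory.fst X interval ≫ v ≫ c.g) hqx
      (by
        intro n σ hσ s
        change _ = c.g.app n (v.app n σ)
        obtain ⟨ht, h⟩ | ⟨_, h⟩ := hK' n σ hσ s
        · rw [h]; exact hqK n ⟨σ, ht⟩ s
        · rw [h, hqx])
      (by
        intro n σ hσ
        obtain ⟨ht, h⟩ | ⟨_, h⟩ := hK' n σ hσ (interval.vertex 1 n)
        · rw [h]; exact (hK1 n ⟨σ, ht⟩).symm
        · rw [h])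
    -- `N` is `x` at vertex 1, so its end at vertex 0 is the corrected component.
    let x' : X ⟶ D := atVertex 0 X ≫ N
    have hx' (n) (σ : X.obj n) : x'.app n σ = N.app n (pair σ (interval.vertex 0 n)) := rfl
    have hqx' (n) (σ : X.obj n) : q.app n (x'.app n σ) = c.g.app n (v.app n σ) := by
      rw [hx', hN]; rfl
    have hx'T (n) (σ : X.obj n) (ht : σ ∈ T.obj n) :
        x'.app n σ = c.L.app n (pair (y.app n ⟨σ, ht⟩) (interval.vertex c.e' n)) := by
      rw [hx', hNR _ _ (Or.inl ht)]
      refine Eq.trans ?_ (hK0 n ⟨σ, ht⟩)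
      obtain ⟨_, h⟩ | ⟨hσ, h⟩ := hK' n σ (Or.inl ht) (interval.vertex 0 n)
      · exact h
      · rw [h]; exact (hKS n ⟨σ, ht⟩ _ hσ).symm
    have hx'H (n) (σ : X.obj n) (hσ : σ ∈ H.obj n) : x'.app n σ = x.app n σ := by
      rw [hx', hNR _ _ (Or.inr hσ)]
      obtain ⟨ht, h⟩ | ⟨_, h⟩ := hK' n σ (Or.inr hσ) (interval.vertex 0 n)
      · rw [h]; exact hKS n ⟨σ, ht⟩ _ hσ
      · exact h
    have memT {n l} (σ : X.obj n) (f : n ⟶ l) (h : B.map f (v.app n σ) ∈ A.obj l) :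
        X.map f σ ∈ T.obj l := by
      have h' := h
      rw [← app_map] at h'
      exact h'
    let w : X ⟶ c.extension :=
      { app n := ↾(fun σ ↦
          { b := v.app n σ
            x := x'.app n σ
            y f h := y.app _ ⟨X.map f σ, memT σ f h⟩
            q_x := hqx' n σ
            q_y f h :=
              (congrArg Subtype.val (hqy _ ⟨X.map f σ, memT σ f h⟩)).trans (app_map v f σ)
            y_comp f φ h h' := by
              refine Eq.trans ?_ (app_map y φ (⟨X.map f σ, memT σ f h⟩ : (T : SSet).obj _))
              congr 1
              exact Subtype.ext (map_map f φ σ).symm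
            L_y f h :=
              (hx'T _ _ (memT σ f h)).symm.trans (app_map x' f σ) })
        naturality n m φ := by
          ext σ
          refine Simplex.ext' (app_map v φ σ) (app_map x' φ σ) ?_
          intro l f h h'
          change y.app _ _ = y.app _ _
          congr 1
          exact Subtype.ext (map_map φ f σ) }
    refine ⟨⟨{ l := w, fac_left := ?_, fac_right := rfl }⟩⟩
    ext n ⟨σ, hσ⟩
    refine Simplex.ext' (huv n σ hσ).symm ((hx'H n σ hσ).trans (hxH n σ hσ)) ?_
    intro l f h h'
    let z : c.Simplex n := u.app n ⟨σ, hσ⟩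
    have hT : X.map f σ ∈ T.obj l := memT σ f h
    change y.app l ⟨X.map f σ, hT⟩ = z.y f h'
    rw [hyS l ⟨X.map f σ, hT⟩ (H.map f hσ)]
    have hu : (u.app l ⟨X.map f σ, H.map f hσ⟩ : c.Simplex l) = z.map f :=
      app_map u f ⟨σ, hσ⟩
    have h1 : B.map (𝟙 l) (z.map f).b ∈ A.obj l := by
      rw [← hu]; exact memA l _ (H.map f hσ) hT
    have h3 : (u.app l ⟨X.map f σ, H.map f hσ⟩ : c.Simplex l).y (𝟙 l)
        (memA l _ (H.map f hσ) hT) = (z.map f).y (𝟙 l) h1 := by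
      congr 1
    refine h3.trans ?_
    exact z.y_congr (Category.comp_id _) _

lemma fibration_proj [Fibration q] : Fibration c.proj := by
  rw [fibration_iff]
  intro _ _ _ h
  simp only [J, MorphismProperty.iSup_iff] at h
  obtain ⟨m, ⟨k⟩⟩ := h
  exact c.hasLiftingProperty_proj _

end LiftedContraction

/-- Given the ends of a homotopy on `A`, its lift along a fibration exists. -/
lemma LiftedContraction.exists_lift {B : SSet.{u}} {A : B.Subcomplex} {D : SSet.{u}}
    (q : D ⟶ (A : SSet)) [Fibration q] (g : B ⟶ (A : SSet)) (e e' : Fin 2)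
    (h : (A : SSet) ⊗ interval ⟶ (A : SSet))
    (h_e : ∀ n (a : (A : SSet).obj n), h.app n (pair a (interval.vertex e n)) = a)
    (h_e' : ∀ n (a : (A : SSet).obj n), h.app n (pair a (interval.vertex e' n)) = g.app n a.1) :
    Nonempty (LiftedContraction A q) := by
  obtain ⟨K, -⟩ := exists_hom_of_rel (X := ((⊥ : D.Subcomplex) : SSet) ⊗ interval) (Y := D)
    (fun _ _ _ ↦ False) (fun n x ↦ x.1.2.elim) (fun _ _ _ _ h ↦ h.elim) (fun _ _ _ h ↦ h)
  obtain ⟨L, hL, hLe, -⟩ := exists_homotopy_lift q ⊥ e (𝟙 D) K (q ▷ interval ≫ h)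
    (fun n d ↦ (h_e n (q.app n d)).symm) (fun _ _ hx ↦ hx.elim) (fun _ _ hx ↦ hx.elim)
  exact ⟨{ g, e, e', h, L, h_e, h_e', q_L n d s := hL n (pair d s), L_e := hLe }⟩

/-! ### Contractions of horns -/

namespace stdSimplex

/-- The simplex of a standard simplex given by a monotone map. -/
def ofOrderHom {N : ℕ} {m : SimplexCategoryᵒᵖ} (f : Fin (m.unop.len + 1) →o Fin (N + 1)) :
    (stdSimplex.{u}.obj ⦋N⦌).obj m := objMk (n := ⦋N⦌) f

lemma asOrderHom_injective {N : ℕ} {m : SimplexCategoryᵒᵖ} :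
    Function.Injective (asOrderHom.{u} (n := N) (m := m)) :=
  fun _ _ h ↦ objEquiv.injective (SimplexCategory.Hom.ext _ _ h)

end stdSimplex

open SSet.stdSimplex

/-- A homotopy of endomorphisms of a standard simplex given by a monotone map. -/
def stdSimplexHomotopy {N : ℕ} (τ : Fin (N + 1) → Fin 2 → Fin (N + 1))
    (hτ : ∀ i i' a a', i ≤ i' → a ≤ a' → τ i a ≤ τ i' a') :
    (Δ[N] : SSet.{u}) ⊗ interval ⟶ Δ[N] where
  app _ := ↾(fun z ↦ ofOrderHom
    { toFun i := τ (asOrderHom z.1 i) (asOrderHom (n := 1) z.2 i)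
      monotone' _ _ hij := hτ _ _ _ _ ((asOrderHom z.1).monotone hij)
        ((asOrderHom (n := 1) z.2).monotone hij) })
  naturality _ _ _ := rfl

/-- The endomorphism of a standard simplex given by a monotone map. -/
def stdSimplexEnd {N : ℕ} (f : Fin (N + 1) →o Fin (N + 1)) : (Δ[N] : SSet.{u}) ⟶ Δ[N] where
  app _ := ↾(fun z ↦ ofOrderHom (f.comp (asOrderHom z)))
  naturality _ _ _ := rfl

/-- A simplex lies in the horn when its vertices together with `k` are not all the vertices. Moving
vertices only to `k` preserves this, so the homotopy stays in the horn; its final map omits `j ≠ k`,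
so it sends the whole simplex into the horn. -/
lemma exists_liftedContraction_of_order {N : ℕ} (k : Fin (N + 1))
    {D : SSet.{u}} (q : D ⟶ (horn.{u} N k : SSet)) [Fibration q]
    (τ : Fin (N + 1) → Fin 2 → Fin (N + 1))
    (hτ : ∀ i i' a a', i ≤ i' → a ≤ a' → τ i a ≤ τ i' a') (hτk : ∀ i a, τ i a = i ∨ τ i a = k)
    (e e' : Fin 2) (hτe : ∀ i, τ i e = i) (j : Fin (N + 1)) (hj : j ≠ k)
    (hτj : ∀ i, τ i e' ≠ j) :
    Nonempty (LiftedContraction (horn.{u} N k) q) := by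
  let g : (Δ[N] : SSet.{u}) ⟶ (horn.{u} N k : SSet) := Subcomplex.lift
    (stdSimplexEnd ⟨fun i ↦ τ i e', fun i i' h ↦ hτ _ _ _ _ h le_rfl⟩) (by
      rintro m _ ⟨s, rfl⟩
      refine (mem_horn_iff k _).2 fun H ↦ ?_
      have := H.symm.le (Set.mem_univ j)
      rw [Set.mem_union] at this
      obtain ⟨i, hi⟩ | h := this
      · exact hτj _ hi
      · exact hj h)
  let h : (horn.{u} N k : SSet) ⊗ interval ⟶ (horn.{u} N k : SSet) := Subcomplex.lift
    ((horn.{u} N k).ι ▷ interval ≫ stdSimplexHomotopy τ hτ) (by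
      rintro m _ ⟨⟨⟨s, hs⟩, a⟩, rfl⟩
      refine (mem_horn_iff k _).2 fun H ↦ (mem_horn_iff k _).1 hs ?_
      rw [Set.eq_univ_iff_forall] at H ⊢
      intro i
      rw [Set.mem_union]
      obtain ⟨l, hl⟩ | h := H i
      · obtain h' | h' := hτk (asOrderHom s l) (asOrderHom (n := 1) a l)
        · exact Or.inl ⟨l, h'.symm.trans hl⟩
        · exact Or.inr (hl.symm.trans h')
      · exact Or.inr h)
  refine LiftedContraction.exists_lift q g e e' h ?_ ?_
  · rintro n ⟨s, hs⟩
    refine Subtype.ext (asOrderHom_injective ?_)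
    ext i : 2
    exact hτe _
  · rintro n ⟨s, hs⟩
    rfl

lemma exists_liftedContraction_horn {N : ℕ} (k : Fin (N + 2)) {D : SSet.{u}}
    (q : D ⟶ (horn.{u} (N + 1) k : SSet)) [Fibration q] :
    Nonempty (LiftedContraction (horn.{u} (N + 1) k) q) := by
  by_cases hk : k = 0
  · subst hk
    -- For `k = 0` everything contracts to the vertex 0. Monotonicity forces the identity to be at
    -- the end 1; the omitted vertex is 1.
    refine exists_liftedContraction_of_order 0 q (fun i a ↦ if a = 0 then 0 else i) ?_ ?_ 1 0
      ?_ 1 (by simp) ?_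
    · intro i i' a a' hi ha
      split_ifs with h1 h2 h3
      · exact le_rfl
      · exact Fin.zero_le _
      · subst h3
        exact (h1 (Fin.le_zero_iff.1 ha)).elim
      · exact hi
    · intro i a
      split_ifs <;> simp
    · simp
    · simp
  -- For `k > 0` the homotopy goes from the identity to `max i k`, which omits the vertex 0.
  · refine exists_liftedContraction_of_order k q (fun i a ↦ if a = 0 then i else max i k) ?_ ?_
      0 1 ?_ 0 (Ne.symm hk) ?_
    · intro i i' a a' hi ha
      split_ifs with h1 h2 h3
      · exact hi
      · exact hi.trans (le_max_left _ _)
      · subst h3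
        exact (h1 (Fin.le_zero_iff.1 ha)).elim
      · exact max_le_max hi le_rfl
    · intro i a
      split_ifs
      · exact Or.inl rfl
      · exact max_choice _ _
    · simp
    · intro i h
      simp only [one_ne_zero, if_false] at h
      exact hk (Fin.le_zero_iff.1 ((le_max_right i k).trans h.le))

/-- The fibration extension property for horn inclusions. -/
lemma exists_extension_horn {κ : Cardinal.{u}} (hκ : κ.IsRegular) {N : ℕ} (k : Fin (N + 2))
    {D : SSet.{u}} (q : D ⟶ (horn.{u} (N + 1) k : SSet)) (hq : IsSmallKanFibration κ q) :
    ∃ (E : SSet.{u}) (p : E ⟶ Δ[N + 1]) (f : D ⟶ E), IsSmallKanFibration κ p ∧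
      IsPullback f q p (horn.{u} (N + 1) k).ι := by
  have := hq.1
  obtain ⟨c⟩ := exists_liftedContraction_horn k q
  exact ⟨_, _, _, ⟨c.fibration_proj, c.isSmallMap_proj hκ hq.2⟩, c.isPullback⟩

/-! ### Labelled families and their classifier -/

/-- A set of cardinality `κ`. -/
def Label (κ : Cardinal.{u}) : Type u := Quotient.out κ

lemma mk_label (κ : Cardinal.{u}) : Cardinal.mk (Label κ) = κ := Cardinal.mk_out κ

/-- A family of sets of cardinality `< κ` indexed by the simplices of `X` with an action of the
simplicial operators. The sets are subsets of a fixed set of cardinality `κ`, so that families can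
be pulled back strictly functorially. -/
@[ext]
structure Family (κ : Cardinal.{u}) (X : SSet.{u}) where
  /-- the members of the family -/
  fib : ∀ {n : SimplexCategoryᵒᵖ}, X.obj n → Set (Label κ)
  /-- the simplicial operators, extended by the identity outside of the members -/
  act : ∀ {n m : SimplexCategoryᵒᵖ}, (n ⟶ m) → X.obj n → Label κ → Label κ
  act_mem : ∀ {n m : SimplexCategoryᵒᵖ} (f : n ⟶ m) (x : X.obj n) {v}, v ∈ fib x →
    act f x v ∈ fib (X.map f x)
  act_id : ∀ {n : SimplexCategoryᵒᵖ} (x : X.obj n) {v}, v ∈ fib x → act (𝟙 n) x v = v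
  act_comp : ∀ {n m l : SimplexCategoryᵒᵖ} (f : n ⟶ m) (g : m ⟶ l) (x : X.obj n) {v}, v ∈ fib x →
    act (f ≫ g) x v = act g (X.map f x) (act f x v)
  act_of_notMem : ∀ {n m : SimplexCategoryᵒᵖ} (f : n ⟶ m) (x : X.obj n) {v}, v ∉ fib x →
    act f x v = v
  card_lt : ∀ {n : SimplexCategoryᵒᵖ} (x : X.obj n), Cardinal.mk (fib x) < κ

namespace Family

variable {κ : Cardinal.{u}} {X Y : SSet.{u}}

/-- Fixing `act` outside the members removes irrelevant data, so that equality of families can be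
tested on members. -/
lemma ext' {F G : Family κ X} (h : ∀ {n : SimplexCategoryᵒᵖ} (x : X.obj n), F.fib x = G.fib x)
    (h' : ∀ {n m : SimplexCategoryᵒᵖ} (f : n ⟶ m) (x : X.obj n) (v), v ∈ F.fib x →
      F.act f x v = G.act f x v) : F = G := by
  refine Family.ext (by funext n x; exact h x) ?_
  funext n m f x v
  by_cases hv : v ∈ F.fib x
  · exact h' f x v hv
  · rw [F.act_of_notMem f x hv, G.act_of_notMem f x (by rwa [← h])]

/-- The pullback of a family. -/
def comap (F : Family κ Y) (φ : X ⟶ Y) : Family κ X where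
  fib {n} x := F.fib (φ.app n x)
  act {n _} f x := F.act f (φ.app n x)
  act_mem f x v hv := by rw [app_map]; exact F.act_mem f _ hv
  act_id x v hv := F.act_id _ hv
  act_comp f g x v hv := by rw [app_map]; exact F.act_comp f g _ hv
  act_of_notMem f x v hv := F.act_of_notMem f _ hv
  card_lt x := F.card_lt _

/-- The total space of a family. -/
def total (F : Family κ X) : SSet.{u} where
  obj n := {z : X.obj n × Label κ // z.2 ∈ F.fib z.1}
  map f := ↾(fun z ↦ ⟨(X.map f z.1.1, F.act f z.1.1 z.1.2), F.act_mem f _ z.2⟩)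
  map_id n := by
    refine ConcreteCategory.hom_ext _ _ fun z ↦ ?_
    apply Subtype.ext
    apply Prod.ext
    · exact Functor.map_id_apply X n _
    · exact F.act_id _ z.2
  map_comp f g := by
    refine ConcreteCategory.hom_ext _ _ fun z ↦ ?_
    apply Subtype.ext
    apply Prod.ext
    · exact Functor.map_comp_apply X f g _
    · exact F.act_comp f g _ z.2

/-- The simplex of the total space given by a member of a set of the family. -/
def elem (F : Family κ X) {n : SimplexCategoryᵒᵖ} (x : X.obj n) (v : Label κ)
    (hv : v ∈ F.fib x) : F.total.obj n := ⟨(x, v), hv⟩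

lemma exists_elem (F : Family κ X) {n : SimplexCategoryᵒᵖ} (z : F.total.obj n) :
    ∃ x v hv, z = F.elem x v hv := ⟨z.1.1, z.1.2, z.2, rfl⟩

lemma elem_inj {F : Family κ X} {n : SimplexCategoryᵒᵖ} {x x' : X.obj n} {v v'} {hv hv'}
    (h : F.elem x v hv = F.elem x' v' hv') : x = x' ∧ v = v' :=
  Prod.mk.inj (congrArg Subtype.val h)

lemma elem_congr {F : Family κ X} {n : SimplexCategoryᵒᵖ} {x x' : X.obj n} {v v'}
    (hx : x = x') (h : v = v') (hv) : F.elem x v hv = F.elem x' v' (h ▸ hx ▸ hv) := by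
  subst hx h; rfl

/-- The projection of the total space. -/
def proj (F : Family κ X) : F.total ⟶ X where
  app _ := ↾(fun z ↦ z.1.1)
  naturality _ _ _ := rfl

lemma isSmallMap_proj (F : Family κ X) : IsSmallMap κ F.proj := by
  intro n x
  refine (Cardinal.mk_le_of_injective (f := fun z : {e : F.total.obj n // F.proj.app n e = x} ↦
    (⟨z.1.1.2, by have h := z.1.2; rwa [show z.1.1.1 = x from z.2] at h⟩ : F.fib x)) ?_).trans_lt
    (F.card_lt x)
  rintro ⟨z, hz⟩ ⟨z', hz'⟩ h
  exact Subtype.ext (Subtype.ext (Prod.ext (hz.trans hz'.symm) (congrArg Subtype.val h)))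

/-- The map from the total space of a pullback. -/
def comapTotal (F : Family κ Y) (φ : X ⟶ Y) : (F.comap φ).total ⟶ F.total where
  app n := ↾(fun z ↦ F.elem (φ.app n z.1.1) z.1.2 z.2)
  naturality n m f := by
    ext z
    exact elem_congr (app_map φ f _) rfl _

lemma isPullback_comap (F : Family κ Y) (φ : X ⟶ Y) :
    IsPullback (F.comapTotal φ) (F.comap φ).proj F.proj φ := by
  refine isPullback_of_existsUnique rfl ?_ ?_
  · rintro n z z' h h'
    exact Subtype.ext (Prod.ext h' (elem_inj h).2)
  · rintro n z x h
    obtain ⟨y, v, hv, rfl⟩ := F.exists_elem z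
    obtain rfl : y = φ.app n x := h
    exact ⟨(F.comap φ).elem x v hv, rfl, rfl⟩

lemma fibration_proj_comap (F : Family κ Y) [hF : Fibration F.proj] (φ : X ⟶ Y) :
    Fibration (F.comap φ).proj := by
  rw [fibration_iff] at hF ⊢
  exact MorphismProperty.of_isPullback (F.isPullback_comap φ) hF

/-- The projection of a family is a fibration if it is so over each simplex. -/
lemma fibration_proj_of_simplices (F : Family κ X)
    (h : ∀ (n : SimplexCategory) (x : X.obj (op n)),
      Fibration (F.comap (yonedaEquiv.symm x)).proj) : Fibration F.proj := by
  rw [fibration_iff]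
  intro _ _ _ hJ
  simp only [J, MorphismProperty.iSup_iff] at hJ
  obtain ⟨m, ⟨k⟩⟩ := hJ
  refine ⟨fun {t b} sq ↦ ?_⟩
  -- The base of a horn lifting problem is a simplex `x`, so the problem can be solved in the
  -- pullback along `x`.
  obtain ⟨x, rfl⟩ := yonedaEquiv.symm.surjective b
  have := h _ x
  have pb := F.isPullback_comap (yonedaEquiv.symm x)
  have sq' : CommSq (pb.lift t _ sq.w) Λ[m + 1, k].ι (F.comap (yonedaEquiv.symm x)).proj (𝟙 _) :=
    ⟨by simp⟩
  refine ⟨⟨{ l := sq'.lift ≫ F.comapTotal _, fac_left := ?_, fac_right := ?_ }⟩⟩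
  · rw [CommSq.fac_left_assoc, pb.lift_fst]
  · rw [Category.assoc, pb.w, CommSq.fac_right_assoc, Category.id_comp]

/-- The tautological simplex of a standard simplex. -/
def idSimplex (n : SimplexCategoryᵒᵖ) : (stdSimplex.{u}.obj n.unop).obj n :=
  stdSimplex.objEquiv.symm (𝟙 _)

lemma map_idSimplex {n m : SimplexCategoryᵒᵖ} (f : n ⟶ m) :
    (stdSimplex.{u}.obj n.unop).map f (idSimplex n) =
      (stdSimplex.{u}.map f.unop).app m (idSimplex m) := by
  refine stdSimplex.objEquiv.injective ?_
  change f.unop ≫ 𝟙 _ = 𝟙 _ ≫ f.unop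
  rw [Category.comp_id, Category.id_comp]

variable (κ) in
/-- The simplicial set which classifies small fibrations. -/
def classifier : SSet.{u} where
  obj n := {F : Family κ (stdSimplex.{u}.obj n.unop) // Fibration F.proj}
  map f := ↾(fun F ↦ ⟨F.1.comap (SSet.stdSimplex.map f.unop),
    have := F.2; F.1.fibration_proj_comap _⟩)
  map_id n := ConcreteCategory.hom_ext _ _ fun F ↦
    Subtype.ext (congrArg F.1.comap (CategoryTheory.Functor.map_id SSet.stdSimplex n.unop))
  map_comp f g := ConcreteCategory.hom_ext _ _ fun F ↦
    Subtype.ext (congrArg F.1.comap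
      (CategoryTheory.Functor.map_comp SSet.stdSimplex g.unop f.unop))

lemma comap_yonedaEquiv_symm_map (F : Family κ X) {n m : SimplexCategoryᵒᵖ} (f : n ⟶ m)
    (x : X.obj n) : F.comap (yonedaEquiv.symm (X.map f x)) =
      (F.comap (yonedaEquiv.symm x)).comap (SSet.stdSimplex.map f.unop) :=
  congrArg F.comap (yonedaEquiv_symm_naturality_left f.unop x).symm

/-- The map to the classifier given by a family which is a fibration. -/
def classify (F : Family κ X) (hF : Fibration F.proj) : X ⟶ classifier κ where
  app n := ↾(fun x ↦ ⟨F.comap (yonedaEquiv.symm x), F.fibration_proj_comap _⟩)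
  naturality n m f := by
    refine ConcreteCategory.hom_ext _ _ fun x ↦ ?_
    exact Subtype.ext (F.comap_yonedaEquiv_symm_map f x)

lemma fib_idSimplex_map (c : X ⟶ classifier κ) {n m : SimplexCategoryᵒᵖ} (f : n ⟶ m)
    (x : X.obj n) : (c.app m (X.map f x)).1 =
      (c.app n x).1.comap (SSet.stdSimplex.map f.unop) :=
  congrArg Subtype.val (app_map c f x)

lemma comap_fib_idSimplex {n m : SimplexCategoryᵒᵖ} (F : Family κ (stdSimplex.{u}.obj n.unop))
    (f : n ⟶ m) : (F.comap (SSet.stdSimplex.map f.unop)).fib (idSimplex m) =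
      F.fib ((stdSimplex.{u}.obj n.unop).map f (idSimplex n)) := by
  rw [map_idSimplex]; rfl

lemma comap_act_idSimplex {n m l : SimplexCategoryᵒᵖ} (F : Family κ (stdSimplex.{u}.obj n.unop))
    (f : n ⟶ m) (g : m ⟶ l) : (F.comap (SSet.stdSimplex.map f.unop)).act g (idSimplex m) =
      F.act g ((stdSimplex.{u}.obj n.unop).map f (idSimplex n)) := by
  rw [map_idSimplex]; rfl

/-- The family classified by a map to the classifier. -/
def ofMap (c : X ⟶ classifier κ) : Family κ X where
  fib {n} x := (c.app n x).1.fib (idSimplex n)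
  act {n _} f x := (c.app n x).1.act f (idSimplex n)
  act_mem f x v hv := by
    rw [fib_idSimplex_map, comap_fib_idSimplex]
    exact act_mem _ _ _ hv
  act_id x v hv := act_id _ _ hv
  act_comp f g x v hv := by
    rw [fib_idSimplex_map, comap_act_idSimplex]
    exact act_comp _ _ _ _ hv
  act_of_notMem f x v hv := act_of_notMem _ _ _ hv
  card_lt x := card_lt _ _

lemma ofMap_comp (f : X ⟶ Y) (c : Y ⟶ classifier κ) : ofMap (f ≫ c) = (ofMap c).comap f := rfl

lemma ofMap_classify (F : Family κ X) (hF : Fibration F.proj) : ofMap (F.classify hF) = F := by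
  have key {n : SimplexCategoryᵒᵖ} (x : X.obj n) :
      (yonedaEquiv.symm x).app n (idSimplex n) = x := Functor.map_id_apply X n x
  refine Family.ext' ?_ ?_
  · intro n x
    exact congrArg F.fib (key x)
  · intro n m f x v _
    exact congrArg (fun y ↦ F.act f y v) (key x)

/-- A simplex `s` of the standard simplex is the image of the tautological simplex under an
operator, so naturality of `c` recovers the whole family from the values used in `ofMap`. -/
lemma ofMap_comap (c : X ⟶ classifier κ) {n : SimplexCategoryᵒᵖ} (x : X.obj n) :
    (ofMap c).comap (yonedaEquiv.symm x) = (c.app n x).1 := by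
  have key {m : SimplexCategoryᵒᵖ} (s : (stdSimplex.{u}.obj n.unop).obj m) :
      (stdSimplex.{u}.obj n.unop).map (stdSimplex.objEquiv s).op (idSimplex n) = s := by
    refine stdSimplex.objEquiv.injective ?_
    change stdSimplex.objEquiv s ≫ 𝟙 _ = _
    exact Category.comp_id _
  have key' {m : SimplexCategoryᵒᵖ} (s : (stdSimplex.{u}.obj n.unop).obj m) :
      (c.app m ((yonedaEquiv.symm x).app m s)).1 =
        (c.app n x).1.comap (SSet.stdSimplex.map (stdSimplex.objEquiv s)) :=
    fib_idSimplex_map c (stdSimplex.objEquiv s).op x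
  refine Family.ext' ?_ ?_
  · intro m s
    refine (congrArg (fun F ↦ F.fib (idSimplex m)) (key' s)).trans ?_
    refine (comap_fib_idSimplex _ (stdSimplex.objEquiv s).op).trans ?_
    exact congrArg _ (key s)
  · intro m l f s v _
    refine (congrArg (fun F ↦ F.act f (idSimplex m) v) (key' s)).trans ?_
    refine (congrFun (comap_act_idSimplex _ (stdSimplex.objEquiv s).op f) v).trans ?_
    exact congrArg (fun y ↦ (c.app n x).1.act f y v) (key s)

lemma ofMap_injective : Function.Injective (ofMap (κ := κ) (X := X)) := by
  intro c c' h
  refine NatTrans.ext (funext fun n ↦ ConcreteCategory.hom_ext _ _ fun x ↦ Subtype.ext ?_)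
  exact (ofMap_comap c x).symm.trans
    ((congrArg (fun F ↦ F.comap (yonedaEquiv.symm x)) h).trans (ofMap_comap c' x))

lemma fibration_proj_ofMap (c : X ⟶ classifier κ) : Fibration (ofMap c).proj := by
  refine fibration_proj_of_simplices _ fun n x ↦ ?_
  rw [ofMap_comap]
  exact (c.app (op n) x).2

end Family

/-! ### Realignment -/

/-- By the pullback property, a fiber of `p` that meets the image of `k` lies entirely in it. Such
fibers carry the labels of `F` and the others an arbitrary embedding, so the two rules never meet in
one fiber. -/
lemma exists_labelling {κ : Cardinal.{u}} {A B E : SSet.{u}} {j : A ⟶ B} [Mono j] {p : E ⟶ B}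
    (hp : IsSmallMap κ p) (F : Family κ A) {k : F.total ⟶ E} (sq : IsPullback k F.proj p j)
    (n : SimplexCategoryᵒᵖ) :
    ∃ enc : E.obj n → Label κ,
      (∀ e e', p.app n e = p.app n e' → enc e = enc e' → e = e') ∧
      ∀ x v hv, enc (k.app n (F.elem x v hv)) = v := by
  classical
  have hj : Function.Injective (j.app n) := (mono_iff_injective _).1 inferInstance
  have sqn := (Limits.Types.isPullback_iff _ _ _ _).1 (sq.app n)
  have hpk (z : F.total.obj n) : p.app n (k.app n z) = j.app n (F.proj.app n z) :=
    app_congr sq.w z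
  have hk : Function.Injective (k.app n) := fun z z' h ↦
    sqn.2.1 z z' ⟨h, hj (by rw [← hpk, ← hpk, h])⟩
  have hemb (b : B.obj n) : Nonempty ({e : E.obj n // p.app n e = b} ↪ Label κ) := by
    rw [← Cardinal.le_def, mk_label]
    exact (hp n b).le
  obtain ⟨emb⟩ : Nonempty (∀ b : B.obj n, {e : E.obj n // p.app n e = b} ↪ Label κ) :=
    ⟨fun b ↦ (hemb b).some⟩
  let enc (e : E.obj n) : Label κ :=
    if h : ∃ z : F.total.obj n, k.app n z = e then h.choose.1.2 else emb (p.app n e) ⟨e, rfl⟩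
  have enc_k (z : F.total.obj n) : enc (k.app n z) = z.1.2 := by
    have h : ∃ z' : F.total.obj n, k.app n z' = k.app n z := ⟨z, rfl⟩
    have := hk h.choose_spec
    simp only [enc, dif_pos h]
    rw [this]
  refine ⟨enc, ?_, fun x v hv ↦ enc_k _⟩
  have lift (z : F.total.obj n) (e : E.obj n) (h : p.app n (k.app n z) = p.app n e) :
      ∃ z' : F.total.obj n, k.app n z' = e ∧ F.proj.app n z' = F.proj.app n z :=
    sqn.2.2 e (F.proj.app n z) (h.symm.trans (hpk z))
  intro e e' hpe henc
  by_cases h : ∃ z : F.total.obj n, k.app n z = e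
  · obtain ⟨z, rfl⟩ := h
    obtain ⟨z', rfl, hz⟩ := lift z e' hpe
    rw [enc_k, enc_k] at henc
    congr 1
    exact Subtype.ext (Prod.ext hz.symm henc)
  · have h' : ¬ ∃ z : F.total.obj n, k.app n z = e' := by
      rintro ⟨z, rfl⟩
      obtain ⟨z', h'', -⟩ := lift z e hpe.symm
      exact h ⟨z', h''⟩
    simp only [enc, dif_neg h, dif_neg h'] at henc
    have aux (b : B.obj n) (hb : p.app n e' = b) (hb' : p.app n e = b)
      (H : emb b ⟨e, hb'⟩ = emb b ⟨e', hb⟩) : e = e' :=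
      congrArg Subtype.val ((emb b).injective H)
    refine aux _ rfl hpe ?_
    refine Eq.trans ?_ henc
    have aux' (b b' : B.obj n) (hb : p.app n e = b) (hb' : p.app n e = b') :
        emb b ⟨e, hb⟩ = emb b' ⟨e, hb'⟩ := by
      subst hb; subst hb'; rfl
    exact aux' _ _ _ _

/-- A small map over `B` whose restriction along a monomorphism `j` is the total space of a family
`F` is isomorphic to the total space of a family which restricts to `F`. -/
lemma Family.exists_realignment {κ : Cardinal.{u}} {A B E : SSet.{u}} {j : A ⟶ B} [Mono j]
    {p : E ⟶ B} (hp : IsSmallMap κ p) (F : Family κ A) {k : F.total ⟶ E}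
    (sq : IsPullback k F.proj p j) :
    ∃ (G : Family κ B) (e : E ≅ G.total), G.comap j = F ∧ e.hom ≫ G.proj = p := by
  classical
  choose enc enc_inj enc_k using exists_labelling hp F sq
  have hpk {n} (z : F.total.obj n) : p.app n (k.app n z) = j.app n (F.proj.app n z) :=
    app_congr sq.w z
  -- The structure of `E` is transported along `enc`, which is injective on each fiber.
  let fib {n : SimplexCategoryᵒᵖ} (b : B.obj n) : Set (Label κ) :=
    {v | ∃ e : E.obj n, p.app n e = b ∧ enc n e = v}
  let act {n m : SimplexCategoryᵒᵖ} (f : n ⟶ m) (b : B.obj n) (v : Label κ) : Label κ :=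
    if h : v ∈ fib b then enc m (E.map f h.choose) else v
  have act_enc {n m : SimplexCategoryᵒᵖ} (f : n ⟶ m) (b : B.obj n) (e : E.obj n)
      (he : p.app n e = b) : act f b (enc n e) = enc m (E.map f e) := by
    have h : enc n e ∈ fib b := ⟨e, he, rfl⟩
    have h' : h.choose = e :=
      enc_inj n _ _ (h.choose_spec.1.trans he.symm) h.choose_spec.2
    simp only [act, dif_pos h]
    rw [h']
  let G : Family κ B :=
    { fib := fib
      act := act
      act_mem {n m} f b v hv := by
        obtain ⟨e, he, rfl⟩ := hv
        rw [act_enc f b e he]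
        exact ⟨_, by rw [app_map, he], rfl⟩
      act_id {n} b v hv := by
        obtain ⟨e, he, rfl⟩ := hv
        rw [act_enc _ b e he, Functor.map_id_apply]
      act_comp {n m l} f g b v hv := by
        obtain ⟨e, he, rfl⟩ := hv
        rw [act_enc _ b e he, act_enc _ b e he, act_enc _ _ _ (by rw [app_map, he]),
          Functor.map_comp_apply]
      act_of_notMem {n m} f b v hv := dif_neg hv
      card_lt {n} b := by
        refine lt_of_le_of_lt ?_ (hp n b)
        refine Cardinal.mk_le_of_surjective (f := fun e ↦ ⟨enc n e.1, e.1, e.2, rfl⟩) ?_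
        rintro ⟨v, e, he, rfl⟩
        exact ⟨⟨e, he⟩, rfl⟩ }
  let Φ : E ⟶ G.total :=
    { app n := ↾(fun e ↦ G.elem (p.app n e) (enc n e) ⟨e, rfl, rfl⟩)
      naturality n m f := by
        refine ConcreteCategory.hom_ext _ _ fun e ↦ ?_
        exact elem_congr (F := G) (v := enc m (E.map f e)) (v' := act f (p.app n e) (enc n e))
          (app_map p f e) (act_enc f _ e rfl).symm ⟨E.map f e, rfl, rfl⟩ }
  have : IsIso Φ := by
    rw [NatTrans.isIso_iff_isIso_app]
    intro n
    rw [isIso_iff_bijective]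
    constructor
    · intro e e' h
      have h' := elem_inj (F := G) (x := p.app n e) (x' := p.app n e') (v := enc n e)
        (v' := enc n e') (hv := ⟨e, rfl, rfl⟩) (hv' := ⟨e', rfl, rfl⟩) h
      exact enc_inj n e e' h'.1 h'.2
    · intro z
      obtain ⟨b, v, ⟨e, rfl, rfl⟩, rfl⟩ := G.exists_elem z
      exact ⟨e, rfl⟩
  have hfib {n : SimplexCategoryᵒᵖ} (a : A.obj n) : fib (j.app n a) = F.fib a := by
    ext v
    constructor
    · rintro ⟨e, he, rfl⟩
      obtain ⟨z, rfl, rfl⟩ := ((Limits.Types.isPullback_iff _ _ _ _).1 (sq.app n)).2.2 e a he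
      obtain ⟨a, v, hv, rfl⟩ := F.exists_elem z
      rw [enc_k]
      exact hv
    · intro hv
      exact ⟨k.app n (F.elem a v hv), hpk _, enc_k _ _ _ _⟩
  refine ⟨G, asIso Φ, Family.ext' hfib ?_, rfl⟩
  intro n m f a v hv
  have hv' : v ∈ F.fib a := by rw [← hfib]; exact hv
  have h1 : act f (j.app n a) (enc n (k.app n (F.elem a v hv'))) =
      enc m (E.map f (k.app n (F.elem a v hv'))) := act_enc f _ _ (hpk _)
  rw [enc_k, ← app_map] at h1
  exact h1.trans (enc_k m _ _ (F.act_mem f a hv'))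

/-- Realignment along the empty subcomplex, where there are no labels to respect. -/
lemma Family.exists_of_isSmallMap {κ : Cardinal.{u}} {A D : SSet.{u}} {q : D ⟶ A}
    (hq : IsSmallMap κ q) : ∃ (F : Family κ A) (e : D ≅ F.total), e.hom ≫ F.proj = q := by
  let F₀ : Family κ ((⊥ : A.Subcomplex) : SSet) :=
    { fib _ := ∅
      act _ _ v := v
      act_mem _ _ _ hv := hv.elim
      act_id _ _ _ := rfl
      act_comp _ _ _ _ _ := rfl
      act_of_notMem _ _ _ _ := rfl
      card_lt x := x.2.elim }
  let k : F₀.total ⟶ D :=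
    { app n := ↾(fun z ↦ z.1.1.2.elim)
      naturality n m f := ConcreteCategory.hom_ext _ _ fun z ↦ z.1.1.2.elim }
  obtain ⟨F, e, -, h⟩ := F₀.exists_realignment (j := (⊥ : A.Subcomplex).ι) hq (k := k)
    (isPullback_of_existsUnique
      (by
        ext n z
        exact z.1.1.2.elim) (fun n z ↦ z.1.1.2.elim) (fun n e a ↦ a.2.elim))
  exact ⟨F, e, h⟩

/-! ### The classifier is Kan, and maps to Kan complexes extend -/

/-- The classifier of small fibrations is a Kan complex. -/
lemma kanComplex_classifier {κ : Cardinal.{u}} (hκ : κ.IsRegular) :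
    KanComplex (Family.classifier κ) := by
  refine (isFibrant_iff _).2 ⟨?_⟩
  rw [fibrations_eq]
  intro _ _ _ hf
  simp only [J, MorphismProperty.iSup_iff] at hf
  obtain ⟨n, ⟨i⟩⟩ := hf
  refine ⟨fun {t _} _ ↦ ?_⟩
  obtain ⟨E, p, k, hp, sq⟩ := exists_extension_horn hκ i (Family.ofMap t).proj
    ⟨Family.fibration_proj_ofMap t, Family.isSmallMap_proj _⟩
  -- The extension `E` restricts to the given family only up to isomorphism; a filler of the horn
  -- needs the equality `hG`.
  obtain ⟨G, e, hG, he⟩ := (Family.ofMap t).exists_realignment hp.2 sq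
  have hGp : Fibration G.proj := by
    have h := hp.1
    rw [fibration_iff] at h ⊢
    rw [← he] at h
    exact (MorphismProperty.cancel_left_of_respectsIso _ _ _).1 h
  exact ⟨⟨{
    l := G.classify hGp
    fac_left := Family.ofMap_injective (by
      rw [Family.ofMap_comp, Family.ofMap_classify, hG])
    fac_right := by subsingleton }⟩⟩

/-- The homotopy extension property for Kan complexes. -/
lemma exists_extension_of_homotopy {A B K : SSet.{u}} [KanComplex K] (j : A ⟶ B) [Mono j]
    (e e' : Fin 2) (H : A ⊗ interval ⟶ K) (f : B ⟶ K)
    (hf : ∀ n (a : A.obj n), H.app n (pair a (interval.vertex e n)) = f.app n (j.app n a)) :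
    ∃ g : B ⟶ K, ∀ n (a : A.obj n),
      H.app n (pair a (interval.vertex e' n)) = g.app n (j.app n a) := by
  let r := Subcomplex.toRange j
  have hr {n} (a : A.obj n) (h) :
      (inv r).app n (⟨j.app n a, h⟩ : (Subcomplex.range j : SSet).obj n) = a :=
    app_congr (IsIso.hom_inv_id r) a
  have hrj {n} (b : B.obj n) (h : b ∈ (Subcomplex.range j).obj n) : ∃ a, j.app n a = b := h
  -- Homotopy lifting against the map from `K` to the point, relative to the image of `j`.
  obtain ⟨L, -, hL, hL'⟩ := exists_homotopy_lift (Limits.terminal.from K) (Subcomplex.range j) e f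
    (inv r ▷ interval ≫ H) (Limits.terminal.from _)
    (fun n b ↦ app_congr (Limits.terminal.hom_ext (f ≫ Limits.terminal.from K)
      (atVertex e B ≫ Limits.terminal.from _)) b)
    (fun n b hb s ↦ app_congr (Limits.terminal.hom_ext
      ((inv r ▷ interval ≫ H) ≫ Limits.terminal.from K)
      ((Subcomplex.range j).ι ▷ interval ≫ Limits.terminal.from _)) (pair ⟨b, hb⟩ s))
    (by
      intro n b hb
      obtain ⟨a, rfl⟩ := hrj b hb
      refine (hf n a).symm.trans ?_
      exact congrArg (fun a ↦ H.app n (pair a (interval.vertex e n))) (hr a hb).symm)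
  refine ⟨atVertex e' B ≫ L, fun n a ↦ ?_⟩
  refine Eq.trans ?_ (hL' n (j.app n a) ⟨a, rfl⟩ (interval.vertex e' n)).symm
  exact congrArg (fun a ↦ H.app n (pair a (interval.vertex e' n))) (hr a _).symm

/-- Maps to a Kan complex extend along trivial cofibrations. -/
lemma IsTrivialCofibration.exists_extension {A B K : SSet.{u}} [hK : KanComplex K] {j : A ⟶ B}
    (hj : IsTrivialCofibration j) (f : A ⟶ K) : ∃ g : B ⟶ K, j ≫ g = f := by
  have := hj.1
  obtain ⟨x, hx⟩ := (hj.2 K hK).2 (MapClass.mk f)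
  obtain ⟨g, rfl⟩ := Quot.exists_rep x
  have h := Quot.eqvGen_exact (r := fun f g : A ⟶ K ↦ Nonempty (Homotopy f g)) hx
  -- Surjectivity on classes gives an extension only up to a zigzag of homotopies. Extendability
  -- along `j` passes through each homotopy in both directions, hence the equivalence.
  suffices ∀ f f' : A ⟶ K, Relation.EqvGen (fun f g : A ⟶ K ↦ Nonempty (Homotopy f g)) f f' →
      ((∃ g : B ⟶ K, j ≫ g = f) ↔ ∃ g : B ⟶ K, j ≫ g = f') from (this _ _ h).1 ⟨g, rfl⟩
  intro f f' h
  induction h with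
  | rel f f' h =>
    obtain ⟨H⟩ := h
    have h0 (n) (a : A.obj n) : H.h.app n (pair a (interval.vertex 0 n)) = f.app n a :=
      app_congr H.h₀ a
    have h1 (n) (a : A.obj n) : H.h.app n (pair a (interval.vertex 1 n)) = f'.app n a :=
      app_congr H.h₁ a
    constructor
    · rintro ⟨g, rfl⟩
      obtain ⟨g', hg'⟩ := exists_extension_of_homotopy j 0 1 H.h g h0
      refine ⟨g', ?_⟩
      ext n a
      exact (hg' n a).symm.trans (h1 n a)
    · rintro ⟨g, rfl⟩
      obtain ⟨g', hg'⟩ := exists_extension_of_homotopy j 1 0 H.h g h1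
      refine ⟨g', ?_⟩
      ext n a
      exact (hg' n a).symm.trans (h0 n a)
  | refl => rfl
  | symm _ _ _ ih => exact ih.symm
  | trans _ _ _ _ _ ih ih' => exact ih.trans ih'

end SSet

theorem mainTheorem7 (κ : Cardinal.{u}) (hκ : κ.IsRegular)
    {D A B : SSet.{u}} (q : D ⟶ A) (hq : SSet.IsSmallKanFibration κ q)
    (j : A ⟶ B) (hj : SSet.IsTrivialCofibration j) :
    ∃ (E : SSet.{u}) (p : E ⟶ B) (k : D ⟶ E),
      SSet.IsSmallKanFibration κ p ∧ IsPullback k q p j := by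
  obtain ⟨F, e, rfl⟩ := SSet.Family.exists_of_isSmallMap hq.2
  have hF : Fibration F.proj := by
    have h := hq.1
    rw [SSet.modelCategoryQuillen.fibration_iff] at h ⊢
    exact (MorphismProperty.cancel_left_of_respectsIso _ _ _).1 h
  have := SSet.kanComplex_classifier hκ
  -- The family classified by `c` restricts along `j` to `F` itself, so its total space pulls back
  -- to that of `F`.
  obtain ⟨c, hc⟩ := hj.exists_extension (F.classify hF)
  have hG : (SSet.Family.ofMap c).comap j = F := by
    rw [← SSet.Family.ofMap_comp, hc, SSet.Family.ofMap_classify]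
  subst hG
  exact ⟨_, (SSet.Family.ofMap c).proj, e.hom ≫ (SSet.Family.ofMap c).comapTotal j,
    ⟨SSet.Family.fibration_proj_ofMap c, SSet.Family.isSmallMap_proj _⟩,
    ((SSet.Family.ofMap c).isPullback_comap j).of_iso e.symm (Iso.refl _) (Iso.refl _)
      (Iso.refl _) (by simp) (by simp) (by simp) (by simp)⟩
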